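/- **Setting.** All spaces are complex. For a Banach algebra $\mathcal A$, a Banach $\mathcal A$-bimodule is a Banach space $E$ with bounded bilinear, associative and commuting left and right actions of $\mathcal A$ (not necessarily unital). The dual $E^*$ is an $\mathcal A$-bimodule through $\langle x, a\cdot\varphi\rangle=\langle x\cdot a,\varphi\rangle$ and $\langle x,\varphi\cdot a\rangle=\langle a\cdot x,\varphi\rangle$. The bimodule $E$ is *dual*, with predual $E_*$, if $E_*$ is a closed submodule of $E^*$ such that $E=(E_*)^*$, i.e. the canonical map $E\to (E_*)^*$ is bijective; its $w^*$-topology is $\sigma(E,E_*)$. A *dual Banach algebra* is a Banach algebra $\mathcal A$ that is dual as a bimodule over itself, with a fixed predual $\mathcal A_*$. A dual Banach $\mathcal A$-bimodule $E$ is *normal* if for each $x\in E$ the maps $a\mapsto a\cdot x$ and $a\mapsto x\cdot a$ are $w^*$-continuous. A *derivation* $D:\mathcal A\to E$ is a bounded linear map with $D(ab)=D(a)\cdot b+a\cdot D(b)$. The dual Banach algebra $\mathcal A$ is *pointwise Connes amenable* if for every $a_0\in\mathcal A$, every normal dual Banach $\mathcal A$-bimodule $E$ and every $w^*$-continuous derivation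 $D:\mathcal A\to E$ there is $x\in E$ with $D(a_0)=a_0\cdot x-x\cdot a_0$. For a Banach $\mathcal A$-bimodule $E$, let $\sigma wc(E)$ be the submodule of all $x\in E$ such that $a\mapsto a\cdot x$ and $a\mapsto x\cdot a$ are continuous from the $w^*$-topology of $\mathcal A$ to the weak topology of $E$. The projective tensor product $\mathcal A\hat\otimes\mathcal A$ is a bimodule with $a\cdot(b\otimes c)=ab\otimes c$, $(b\otimes c)\cdot a=b\otimes ca$; let $\pi:\mathcal A\hat\otimes\mathcal A\to\mathcal A$ be the bounded linear map with $\pi(b\otimes c)=bc$. Then $\pi^*(\mathcal A_*)\subseteq\sigma wc((\mathcal A\hat\otimes\mathcal A)^*)$, and $\pi_{\sigma wc}:\sigma wc((\mathcal A\hat\otimes\mathcal A)^*)^*\to(\mathcal A_*)^*=\mathcal A$ denotes the adjoint of the restriction $\pi^*|_{\mathcal A_*}$. Let $\mathcal L(\mathcal A,\mathcal A^*)$ be the space of bounded linear maps, with $(a\cdot T)(b)=T(ba)$ and $(T\cdot a)(b)=T(b)\cdot a$; it is identified, as a bimodule, with $(\mathcal A\hat\otimes\mathcal A)^*$ through $\langle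 b\otimes c,T\rangle=\langle b,T(c)\rangle$. Let $\imath_{\mathcal A_*}:\mathcal A_*\to(\mathcal A_*)^{**}=\mathcal A^*$ be the canonical map, with adjoint $\imath_{\mathcal A_*}^*:\mathcal A^{**}\to(\mathcal A_*)^*=\mathcal A$. **Theorem 4.2.** Let $\mathcal A$ be a dual Banach algebra with identity $e_{\mathcal A}$. Then: (i) $\mathcal A$ is pointwise Connes amenable if and only if for each $a\in\mathcal A$ there exists $M\in\sigma wc((\mathcal A\hat\otimes\mathcal A)^*)^*$ such that $a\cdot M=M\cdot a$ and $\pi_{\sigma wc}(M)=e_{\mathcal A}$. (ii) $\mathcal A$ is pointwise Connes amenable if and only if for each $a\in\mathcal A$ there exists $M\in(\mathcal A\hat\otimes\mathcal A)^{**}$ such that $\langle T,a\cdot M-M\cdot a\rangle=0$ for each $T\in\sigma wc(\mathcal L(\mathcal A,\mathcal A^*))$, and $\imath_{\mathcal A_*}^*\pi^{**}(M)=e_{\mathcal A}$. -/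

import Mathlib

open scoped TensorProduct Topology

set_option maxSynthPendingDepth 3
set_option linter.unusedSectionVars false

universe u

noncomputable section

/-! ### The projective tensor product of two complex normed spaces -/

section ProjectiveTensorProduct

variable (E F G : Type*) [NormedAddCommGroup E] [NormedSpace ℂ E]
  [NormedAddCommGroup F] [NormedSpace ℂ F] [NormedAddCommGroup G] [NormedSpace ℂ G]

/-- The algebraic tensor product `E ⊗ F`, as a type synonym that carries the projective norm. -/
def AlgTensor : Type _ := E ⊗[ℂ] F

instance : AddCommGroup (AlgTensor E F) := inferInstanceAs (AddCommGroup (E ⊗[ℂ] F))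

instance : Module ℂ (AlgTensor E F) := inferInstanceAs (Module ℂ (E ⊗[ℂ] F))

variable {E F G}

/-- The elementary tensor `x ⊗ y`. -/
def AlgTensor.pure (x : E) (y : F) : AlgTensor E F := x ⊗ₜ[ℂ] y

/-- The element `∑ xᵢ ⊗ yᵢ` given by a finite list of pairs `(xᵢ, yᵢ)`. -/
def AlgTensor.ofList (l : List (E × F)) : AlgTensor E F :=
  (l.map fun p => AlgTensor.pure p.1 p.2).sum

/-- The number `∑ ‖xᵢ‖ ‖yᵢ‖` given by a finite list of pairs `(xᵢ, yᵢ)`. -/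
def AlgTensor.cost (l : List (E × F)) : ℝ := (l.map fun p => ‖p.1‖ * ‖p.2‖).sum

/-- The projective norm: the infimum of `∑ ‖xᵢ‖ ‖yᵢ‖` over all representations
`u = ∑ xᵢ ⊗ yᵢ`. -/
def AlgTensor.projNorm (u : AlgTensor E F) : ℝ :=
  sInf {r : ℝ | ∃ l : List (E × F), AlgTensor.ofList l = u ∧ AlgTensor.cost l = r}

namespace AlgTensor

lemma cost_nonneg (l : List (E × F)) : 0 ≤ cost l := by
  refine List.sum_nonneg fun r hr => ?_
  obtain ⟨p, -, rfl⟩ := List.mem_map.1 hr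
  positivity

lemma ofList_append (l l' : List (E × F)) : ofList (l ++ l') = ofList l + ofList l' := by
  simp [ofList]

lemma ofList_nil : ofList ([] : List (E × F)) = 0 := rfl

lemma ofList_cons (p : E × F) (l : List (E × F)) :
    ofList (p :: l) = pure p.1 p.2 + ofList l := by
  simp [ofList]

lemma smul_pure (c : ℂ) (x : E) (y : F) : c • pure x y = pure (c • x) y := rfl

@[elab_as_elim]
lemma induction {p : AlgTensor E F → Prop} (u : AlgTensor E F) (zero : p 0)
    (tmul : ∀ x y, p (pure x y)) (add : ∀ u v, p u → p v → p (u + v)) : p u :=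
  TensorProduct.induction_on (motive := p) u zero tmul add

lemma cost_append (l l' : List (E × F)) : cost (l ++ l') = cost l + cost l' := by
  simp [cost]

lemma ofList_smul (c : ℂ) (l : List (E × F)) :
    ofList (l.map fun p => (c • p.1, p.2)) = c • ofList l := by
  induction l with
  | nil => simp [ofList_nil]
  | cons p l ih => rw [List.map_cons, ofList_cons, ofList_cons, ih, smul_add, smul_pure]

lemma cost_smul (c : ℂ) (l : List (E × F)) :
    cost (l.map fun p => (c • p.1, p.2)) = ‖c‖ * cost l := by
  simp [cost, Function.comp_def, norm_smul, mul_assoc, List.sum_map_mul_left]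

lemma exists_ofList (u : AlgTensor E F) : ∃ l : List (E × F), ofList l = u := by
  induction u using AlgTensor.induction with
  | zero => exact ⟨[], rfl⟩
  | tmul x y => exact ⟨[(x, y)], by simp [ofList]⟩
  | add u v hu hv =>
    obtain ⟨l, hl⟩ := hu
    obtain ⟨l', hl'⟩ := hv
    exact ⟨l ++ l', by rw [ofList_append, hl, hl']⟩

lemma projNorm_le (l : List (E × F)) : projNorm (ofList l) ≤ cost l :=
  csInf_le ⟨0, by rintro _ ⟨l', -, rfl⟩; exact cost_nonneg l'⟩ ⟨l, rfl, rfl⟩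

lemma le_projNorm {u : AlgTensor E F} {r : ℝ}
    (h : ∀ l : List (E × F), ofList l = u → r ≤ cost l) : r ≤ projNorm u := by
  obtain ⟨l, hl⟩ := exists_ofList u
  refine le_csInf ⟨_, l, hl, rfl⟩ ?_
  rintro _ ⟨l', hl', rfl⟩
  exact h l' hl'

lemma projNorm_nonneg (u : AlgTensor E F) : 0 ≤ projNorm u :=
  le_projNorm fun l _ => cost_nonneg l

lemma projNorm_add_le (u v : AlgTensor E F) : projNorm (u + v) ≤ projNorm u + projNorm v := by
  rw [← sub_le_iff_le_add]
  refine le_projNorm fun l hl => ?_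
  rw [sub_le_iff_le_add, ← sub_le_iff_le_add']
  refine le_projNorm fun l' hl' => ?_
  rw [sub_le_iff_le_add', ← cost_append, ← hl, ← hl', ← ofList_append]
  exact projNorm_le _

lemma projNorm_smul_le (c : ℂ) (u : AlgTensor E F) : projNorm (c • u) ≤ ‖c‖ * projNorm u := by
  have key : ∀ l : List (E × F), ofList l = u → projNorm (c • u) ≤ ‖c‖ * cost l := by
    rintro l rfl
    rw [← cost_smul, ← ofList_smul]
    exact projNorm_le _
  rcases (norm_nonneg c).eq_or_lt with h | h
  · obtain ⟨l, hl⟩ := exists_ofList u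
    simpa [← h] using key l hl
  · rw [← div_le_iff₀' h]
    exact le_projNorm fun l hl => (div_le_iff₀' h).2 (key l hl)

lemma projNorm_zero : projNorm (0 : AlgTensor E F) = 0 :=
  le_antisymm (by simpa [cost, ofList_nil] using (projNorm_le ([] : List (E × F))))
    (projNorm_nonneg _)

lemma projNorm_neg (u : AlgTensor E F) : projNorm (-u) = projNorm u := by
  have h : ∀ v : AlgTensor E F, projNorm (-v) ≤ projNorm v := fun v => by
    simpa using projNorm_smul_le (-1 : ℂ) v
  exact le_antisymm (h u) (by simpa using h (-u))

instance : SeminormedAddCommGroup (AlgTensor E F) :=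
  AddGroupSeminorm.toSeminormedAddCommGroup
    { toFun := projNorm
      map_zero' := projNorm_zero
      add_le' := projNorm_add_le
      neg' := projNorm_neg }

lemma norm_def (u : AlgTensor E F) : ‖u‖ = projNorm u := rfl

instance : NormedSpace ℂ (AlgTensor E F) where
  norm_smul_le := projNorm_smul_le

lemma norm_pure_le (x : E) (y : F) : ‖pure x y‖ ≤ ‖x‖ * ‖y‖ := by
  simpa [ofList, cost, norm_def] using projNorm_le [(x, y)]

/-- The bounded bilinear map `(x, y) ↦ x ⊗ y`. -/
def mk : E →L[ℂ] F →L[ℂ] AlgTensor E F :=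
  LinearMap.mkContinuous₂ (TensorProduct.mk ℂ E F : E →ₗ[ℂ] F →ₗ[ℂ] AlgTensor E F) 1
    fun x y => (norm_pure_le x y).trans_eq (by rw [one_mul])

lemma mk_apply (x : E) (y : F) : mk x y = pure x y := rfl

/-- The linear map on `E ⊗ F` induced by a bounded bilinear map. -/
def liftLin (b : E →L[ℂ] F →L[ℂ] G) : AlgTensor E F →ₗ[ℂ] G :=
  (TensorProduct.lift b.toLinearMap₁₂ : E ⊗[ℂ] F →ₗ[ℂ] G)

lemma liftLin_pure (b : E →L[ℂ] F →L[ℂ] G) (x : E) (y : F) : liftLin b (pure x y) = b x y :=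
  TensorProduct.lift.tmul x y

lemma norm_liftLin_ofList_le (b : E →L[ℂ] F →L[ℂ] G) (l : List (E × F)) :
    ‖liftLin b (ofList l)‖ ≤ ‖b‖ * cost l := by
  induction l with
  | nil => simp [ofList_nil, cost]
  | cons p l ih =>
    have h : cost (p :: l) = ‖p.1‖ * ‖p.2‖ + cost l := by simp [cost]
    rw [ofList_cons, h, mul_add, map_add, liftLin_pure, ← mul_assoc]
    exact (norm_add_le _ _).trans (add_le_add (b.le_opNorm₂ p.1 p.2) ih)

lemma norm_liftLin_le (b : E →L[ℂ] F →L[ℂ] G) (u : AlgTensor E F) :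
    ‖liftLin b u‖ ≤ ‖b‖ * ‖u‖ := by
  rw [norm_def]
  rcases (norm_nonneg b).eq_or_lt with h | h
  · obtain ⟨l, rfl⟩ := exists_ofList u
    refine (norm_liftLin_ofList_le b l).trans_eq ?_
    rw [← h, zero_mul, zero_mul]
  · rw [← div_le_iff₀' h]
    refine le_projNorm fun l hl => (div_le_iff₀' h).2 ?_
    rw [← hl]
    exact norm_liftLin_ofList_le b l

/-- A bounded bilinear map induces a bounded linear map on the algebraic tensor product. -/
def lift (b : E →L[ℂ] F →L[ℂ] G) : AlgTensor E F →L[ℂ] G :=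
  LinearMap.mkContinuous (liftLin b) ‖b‖ (norm_liftLin_le b)

lemma lift_mk (b : E →L[ℂ] F →L[ℂ] G) (x : E) (y : F) : lift b (mk x y) = b x y :=
  liftLin_pure b x y

lemma norm_lift_le (b : E →L[ℂ] F →L[ℂ] G) : ‖lift b‖ ≤ ‖b‖ :=
  LinearMap.mkContinuous_norm_le _ (norm_nonneg b) _

lemma clm_ext {f g : AlgTensor E F →L[ℂ] G} (h : ∀ x y, f (mk x y) = g (mk x y)) : f = g := by
  ext u
  induction u using AlgTensor.induction with
  | zero => rw [map_zero, map_zero]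
  | tmul x y => exact h x y
  | add u v hu hv => rw [map_add, map_add, hu, hv]

end AlgTensor

variable (E F) in
/-- The projective tensor product `E ⊗̂ F`: the completion of `E ⊗ F` in the projective norm. -/
abbrev ProjTensor : Type _ := UniformSpace.Completion (AlgTensor E F)

namespace ProjTensor

/-- The canonical isometric embedding of `E ⊗ F` with dense range. -/
def incl : AlgTensor E F →L[ℂ] ProjTensor E F :=
  (UniformSpace.Completion.toComplₗᵢ (𝕜 := ℂ) (E := AlgTensor E F)).toContinuousLinearMap

lemma denseRange_incl : DenseRange (incl : AlgTensor E F →L[ℂ] ProjTensor E F) :=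
  UniformSpace.Completion.denseRange_coe

lemma norm_incl (u : AlgTensor E F) : ‖(incl u : ProjTensor E F)‖ = ‖u‖ :=
  UniformSpace.Completion.norm_coe u

/-- The bounded bilinear map `(x, y) ↦ x ⊗ y` into `E ⊗̂ F`. -/
def tmul : E →L[ℂ] F →L[ℂ] ProjTensor E F :=
  (ContinuousLinearMap.compL ℂ F (AlgTensor E F) (ProjTensor E F) incl) ∘L AlgTensor.mk

lemma tmul_apply (x : E) (y : F) : (tmul x y : ProjTensor E F) = incl (AlgTensor.mk x y) := rfl

lemma clm_ext {f g : ProjTensor E F →L[ℂ] G} (h : ∀ x y, f (tmul x y) = g (tmul x y)) :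
    f = g := by
  have h1 : f ∘L incl = g ∘L incl := AlgTensor.clm_ext h
  ext u
  exact congrFun (denseRange_incl.equalizer f.continuous g.continuous
    (funext fun v => DFunLike.congr_fun h1 v)) u

variable [CompleteSpace G]

/-- The bounded linear map on `E ⊗̂ F` induced by a bounded bilinear map. -/
def liftFun (b : E →L[ℂ] F →L[ℂ] G) : ProjTensor E F →L[ℂ] G :=
  (AlgTensor.lift b).extend incl

lemma liftFun_tmul (b : E →L[ℂ] F →L[ℂ] G) (x : E) (y : F) : liftFun b (tmul x y) = b x y := by
  rw [tmul_apply, liftFun, ContinuousLinearMap.extend_eq _ denseRange_incl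
    (UniformSpace.Completion.isUniformInducing_coe _), AlgTensor.lift_mk]

lemma norm_liftFun_le (b : E →L[ℂ] F →L[ℂ] G) : ‖liftFun b‖ ≤ ‖b‖ := by
  refine ContinuousLinearMap.opNorm_le_bound _ (norm_nonneg b) fun u => ?_
  refine denseRange_incl.induction_on u
    (isClosed_le (by fun_prop) (by fun_prop)) fun v => ?_
  rw [liftFun, ContinuousLinearMap.extend_eq _ denseRange_incl
    (UniformSpace.Completion.isUniformInducing_coe _), norm_incl]
  exact ContinuousLinearMap.le_of_opNorm_le _ (AlgTensor.norm_lift_le b) v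

/-- The universal property of `E ⊗̂ F`, as a bounded linear map in the bilinear map. -/
def lift : (E →L[ℂ] F →L[ℂ] G) →L[ℂ] (ProjTensor E F →L[ℂ] G) :=
  LinearMap.mkContinuous
    { toFun := liftFun
      map_add' := fun b c => clm_ext fun x y => by
        simp only [add_apply, liftFun_tmul]
      map_smul' := fun r b => clm_ext fun x y => by
        simp only [smul_apply, liftFun_tmul, RingHom.id_apply] }
    1 fun b => by simpa using norm_liftFun_le b

@[simp]
lemma lift_tmul (b : E →L[ℂ] F →L[ℂ] G) (x : E) (y : F) : lift b (tmul x y) = b x y :=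
  liftFun_tmul b x y

end ProjTensor

end ProjectiveTensorProduct

/-! ### Adjoints and weak-star topologies -/

section Duality

variable {E F : Type*} [NormedAddCommGroup E] [NormedSpace ℂ E]
  [NormedAddCommGroup F] [NormedSpace ℂ F]

/-- The Banach space adjoint `f* : F* → E*`, `φ ↦ φ ∘ f`. -/
def adjointMap (f : E →L[ℂ] F) : StrongDual ℂ F →L[ℂ] StrongDual ℂ E :=
  (ContinuousLinearMap.compL ℂ E F ℂ).flip f

@[simp]
lemma adjointMap_apply (f : E →L[ℂ] F) (φ : StrongDual ℂ F) (x : E) :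
    adjointMap f φ x = φ (f x) := rfl

/-- The topology `σ(E, P)` on `E` for a space `P ⊆ E*` of functionals; when `P` is a predual of
`E` this is the weak-star topology of `E = P*`. -/
@[reducible]
def weakStarTopology (P : Submodule ℂ (StrongDual ℂ E)) : TopologicalSpace E :=
  TopologicalSpace.induced (fun x (φ : P) => (φ : StrongDual ℂ E) x) Pi.topologicalSpace

/-- The canonical map `E → P*`, `x ↦ (φ ↦ φ x)`, for a space `P ⊆ E*` of functionals. -/
def evalPredual (P : Submodule ℂ (StrongDual ℂ E)) : E →L[ℂ] StrongDual ℂ P :=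
  adjointMap P.subtypeL ∘L NormedSpace.inclusionInDoubleDual ℂ E

@[simp]
lemma evalPredual_apply (P : Submodule ℂ (StrongDual ℂ E)) (x : E) (φ : P) :
    evalPredual P x φ = (φ : StrongDual ℂ E) x := rfl

lemma weakStar_continuous_eval (P : Submodule ℂ (StrongDual ℂ E)) {φ : StrongDual ℂ E}
    (hφ : φ ∈ P) : @Continuous E ℂ (weakStarTopology P) _ (fun x => φ x) := by
  exact @Continuous.comp E (P → ℂ) ℂ (weakStarTopology P) _ _ _ _
    (continuous_apply (⟨φ, hφ⟩ : P)) continuous_induced_dom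

lemma weakStar_continuous_of_eval {X : Type*} [TopologicalSpace X]
    (P : Submodule ℂ (StrongDual ℂ E)) {g : X → E} (h : ∀ φ ∈ P, Continuous fun x => φ (g x)) :
    @Continuous X E _ (weakStarTopology P) g := by
  let _ := weakStarTopology P
  exact continuous_induced_rng.2 (continuous_pi fun φ => h φ φ.2)

lemma continuous_toWeakSpace_of_eval {X : Type*} [TopologicalSpace X] {g : X → E}
    (h : ∀ φ : StrongDual ℂ E, Continuous fun x => φ (g x)) :
    Continuous fun x => toWeakSpace ℂ E (g x) :=
  WeakBilin.continuous_of_continuous_eval _ h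

lemma continuous_eval_of_toWeakSpace {X : Type*} [TopologicalSpace X] {g : X → E}
    (h : Continuous fun x => toWeakSpace ℂ E (g x)) (φ : StrongDual ℂ E) :
    Continuous fun x => φ (g x) :=
  (WeakBilin.eval_continuous (topDualPairing ℂ E).flip φ).comp h

end Duality

/-! ### Banach bimodules -/

/-- A Banach `A`-bimodule structure on the complex normed space `E`: bounded bilinear left and
right actions `left a x = a · x` and `right a x = x · a`, which are associative and commute with
each other. The unit of `A`, if there is one, need not act as the identity. -/
structure BanachBimodule (A : Type*) [NormedRing A] [NormedAlgebra ℂ A]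
    (E : Type*) [NormedAddCommGroup E] [NormedSpace ℂ E] where
  /-- `left a x = a · x` -/
  left : A →L[ℂ] E →L[ℂ] E
  /-- `right a x = x · a` -/
  right : A →L[ℂ] E →L[ℂ] E
  left_mul : ∀ a b x, left (a * b) x = left a (left b x)
  right_mul : ∀ a b x, right (a * b) x = right b (right a x)
  left_right : ∀ a b x, right b (left a x) = left a (right b x)

namespace BanachBimodule

variable {A : Type*} [NormedRing A] [NormedAlgebra ℂ A]
  {E : Type*} [NormedAddCommGroup E] [NormedSpace ℂ E]

variable (A) in
/-- `A` as a bimodule over itself. -/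
def regular : BanachBimodule A A where
  left := ContinuousLinearMap.mul ℂ A
  right := (ContinuousLinearMap.mul ℂ A).flip
  left_mul a b x := mul_assoc a b x
  right_mul a b x := (mul_assoc x a b).symm
  left_right a b x := mul_assoc a x b

@[simp] lemma regular_left (a x : A) : (regular A).left a x = a * x := rfl

@[simp] lemma regular_right (a x : A) : (regular A).right a x = x * a := rfl

/-- The dual bimodule `E*`: `(a · φ)(x) = φ(x · a)` and `(φ · a)(x) = φ(a · x)`. -/
def dual (B : BanachBimodule A E) : BanachBimodule A (StrongDual ℂ E) where
  left := (ContinuousLinearMap.compL ℂ E E ℂ).flip ∘L B.right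
  right := (ContinuousLinearMap.compL ℂ E E ℂ).flip ∘L B.left
  left_mul a b φ := by ext x; exact congrArg φ (B.right_mul a b x)
  right_mul a b φ := by ext x; exact congrArg φ (B.left_mul a b x)
  left_right a b φ := by ext x; exact congrArg φ (B.left_right b a x)

@[simp] lemma dual_left (B : BanachBimodule A E) (a : A) (φ : StrongDual ℂ E) (x : E) :
    B.dual.left a φ x = φ (B.right a x) := rfl

@[simp] lemma dual_right (B : BanachBimodule A E) (a : A) (φ : StrongDual ℂ E) (x : E) :
    B.dual.right a φ x = φ (B.left a x) := rfl

/-- The bimodule structure on a submodule that is stable under both actions. -/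
def restrict (B : BanachBimodule A E) (S : Submodule ℂ E) (hl : ∀ a, ∀ x ∈ S, B.left a x ∈ S)
    (hr : ∀ a, ∀ x ∈ S, B.right a x ∈ S) : BanachBimodule A S where
  left := LinearMap.mkContinuous₂
    (LinearMap.mk₂ ℂ (fun a (x : S) => (⟨B.left a x, hl a x x.2⟩ : S))
      (fun a b x => Subtype.ext (by simp)) (fun c a x => Subtype.ext (by simp))
      (fun a x y => Subtype.ext (by simp)) (fun c a x => Subtype.ext (by simp)))
    ‖B.left‖ fun a x => B.left.le_opNorm₂ a x
  right := LinearMap.mkContinuous₂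
    (LinearMap.mk₂ ℂ (fun a (x : S) => (⟨B.right a x, hr a x x.2⟩ : S))
      (fun a b x => Subtype.ext (by simp)) (fun c a x => Subtype.ext (by simp))
      (fun a x y => Subtype.ext (by simp)) (fun c a x => Subtype.ext (by simp)))
    ‖B.right‖ fun a x => B.right.le_opNorm₂ a x
  left_mul a b x := Subtype.ext (B.left_mul a b x)
  right_mul a b x := Subtype.ext (B.right_mul a b x)
  left_right a b x := Subtype.ext (B.left_right a b x)

@[simp] lemma coe_restrict_left (B : BanachBimodule A E) (S : Submodule ℂ E) (hl hr) (a : A)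
    (x : S) : (((B.restrict S hl hr).left a x : S) : E) = B.left a x := rfl

@[simp] lemma coe_restrict_right (B : BanachBimodule A E) (S : Submodule ℂ E) (hl hr) (a : A)
    (x : S) : (((B.restrict S hl hr).right a x : S) : E) = B.right a x := rfl

variable (A) in
/-- The bimodule `A ⊗̂ A`: `a · (b ⊗ c) = ab ⊗ c` and `(b ⊗ c) · a = b ⊗ ca`. -/
def tensorSquare : BanachBimodule A (ProjTensor A A) where
  left := ProjTensor.lift ∘L
    (ContinuousLinearMap.compL ℂ A A (A →L[ℂ] ProjTensor A A) ProjTensor.tmul) ∘L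
      ContinuousLinearMap.mul ℂ A
  right := ProjTensor.lift ∘L
    ((ContinuousLinearMap.compL ℂ A (A →L[ℂ] ProjTensor A A) (A →L[ℂ] ProjTensor A A)).flip
      ProjTensor.tmul) ∘L
      (ContinuousLinearMap.compL ℂ A A (ProjTensor A A)).flip ∘L (ContinuousLinearMap.mul ℂ A).flip
  left_mul a b x := by
    refine DFunLike.congr_fun (f := _) (g := ContinuousLinearMap.comp _ _)
      (ProjTensor.clm_ext fun c d => ?_) x
    simp [mul_assoc]
  right_mul a b x := by
    refine DFunLike.congr_fun (f := _) (g := ContinuousLinearMap.comp _ _)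
      (ProjTensor.clm_ext fun c d => ?_) x
    simp [mul_assoc]
  left_right a b x := by
    refine DFunLike.congr_fun (f := ContinuousLinearMap.comp _ _)
      (g := ContinuousLinearMap.comp _ _) (ProjTensor.clm_ext fun c d => ?_) x
    simp

@[simp] lemma tensorSquare_left (a b c : A) :
    (tensorSquare A).left a (ProjTensor.tmul b c) = ProjTensor.tmul (a * b) c := by
  simp [tensorSquare]

@[simp] lemma tensorSquare_right (a b c : A) :
    (tensorSquare A).right a (ProjTensor.tmul b c) = ProjTensor.tmul b (c * a) := by
  simp [tensorSquare]

variable (A) in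
/-- The bimodule `L(A, A*)`: `(a · T)(b) = T(ba)` and `(T · a)(b) = T(b) · a`. -/
def homDual : BanachBimodule A (A →L[ℂ] StrongDual ℂ A) where
  left := (ContinuousLinearMap.compL ℂ A A (StrongDual ℂ A)).flip ∘L
    (ContinuousLinearMap.mul ℂ A).flip
  right := (ContinuousLinearMap.compL ℂ A (StrongDual ℂ A) (StrongDual ℂ A)) ∘L
    (regular A).dual.right
  left_mul a b T := by ext c d; simp [mul_assoc]
  right_mul a b T := by ext c d; simp [mul_assoc]
  left_right a b T := by ext c d; simp

@[simp] lemma homDual_left (a : A) (T : A →L[ℂ] StrongDual ℂ A) (b : A) :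
    (homDual A).left a T b = T (b * a) := rfl

@[simp] lemma homDual_right (a : A) (T : A →L[ℂ] StrongDual ℂ A) (b : A) :
    (homDual A).right a T b = (regular A).dual.right a (T b) := rfl

/-- `P` is a predual of the bimodule `E`: a closed submodule of the bimodule `E*` such that
`E = P*`, that is, the canonical map `E → P*` is bijective (hence, for complete `E`, an
isomorphism of Banach spaces). -/
structure IsPredual (B : BanachBimodule A E) (P : Submodule ℂ (StrongDual ℂ E)) : Prop where
  isClosed : IsClosed (P : Set (StrongDual ℂ E))
  left_mem : ∀ a, ∀ φ ∈ P, B.dual.left a φ ∈ P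
  right_mem : ∀ a, ∀ φ ∈ P, B.dual.right a φ ∈ P
  bijective : Function.Bijective (evalPredual P)

/-- The identification `E = P*` for a predual `P` of `E`. -/
def IsPredual.equiv [CompleteSpace E] {B : BanachBimodule A E}
    {P : Submodule ℂ (StrongDual ℂ E)} (h : B.IsPredual P) : E ≃L[ℂ] StrongDual ℂ P :=
  ContinuousLinearEquiv.ofBijective (evalPredual P)
    (LinearMap.ker_eq_bot.2 h.bijective.1) (LinearMap.range_eq_top.2 h.bijective.2)

@[simp] lemma IsPredual.equiv_apply [CompleteSpace E] {B : BanachBimodule A E}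
    {P : Submodule ℂ (StrongDual ℂ E)} (h : B.IsPredual P) (x : E) (φ : P) :
    h.equiv x φ = (φ : StrongDual ℂ E) x := rfl

/-- A dual bimodule `E` with predual `Q` is normal over the dual Banach algebra `A` with predual
`P`: for each `x` the maps `a ↦ a · x` and `a ↦ x · a` are weak-star continuous. -/
def IsNormal (P : Submodule ℂ (StrongDual ℂ A)) (B : BanachBimodule A E)
    (Q : Submodule ℂ (StrongDual ℂ E)) : Prop :=
  ∀ x : E, Continuous[weakStarTopology P, weakStarTopology Q] (fun a => B.left a x) ∧
    Continuous[weakStarTopology P, weakStarTopology Q] (fun a => B.right a x)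

/-- Derivations `D : A → E`: bounded linear maps with `D(ab) = D(a) · b + a · D(b)`. -/
def IsDerivation (B : BanachBimodule A E) (D : A →L[ℂ] E) : Prop :=
  ∀ a b, D (a * b) = B.right b (D a) + B.left a (D b)

/-- `σwc(E)`: the elements `x` of `E` for which `a ↦ a · x` and `a ↦ x · a` are continuous from
the weak-star topology of `A` (with predual `P`) to the weak topology of `E`. -/
def sigmaWC (P : Submodule ℂ (StrongDual ℂ A)) (B : BanachBimodule A E) : Submodule ℂ E where
  carrier := {x | @Continuous A (WeakSpace ℂ E) (weakStarTopology P) _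
      (fun a => toWeakSpace ℂ E (B.left a x)) ∧
    @Continuous A (WeakSpace ℂ E) (weakStarTopology P) _ (fun a => toWeakSpace ℂ E (B.right a x))}
  add_mem' := by
    rintro x y ⟨hx1, hx2⟩ ⟨hy1, hy2⟩
    let _ := weakStarTopology P
    constructor
    · simpa only [map_add] using! hx1.add hy1
    · simpa only [map_add] using! hx2.add hy2
  zero_mem' := by
    let _ := weakStarTopology P
    constructor
    · simpa only [map_zero] using continuous_const
    · simpa only [map_zero] using continuous_const
  smul_mem' := by
    rintro c x ⟨hx1, hx2⟩
    let _ := weakStarTopology P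
    constructor
    · simpa only [map_smul] using! hx1.const_smul c
    · simpa only [map_smul] using! hx2.const_smul c

lemma mem_sigmaWC_iff {P : Submodule ℂ (StrongDual ℂ A)} {B : BanachBimodule A E} {x : E} :
    x ∈ sigmaWC P B ↔
      @Continuous A (WeakSpace ℂ E) (weakStarTopology P) _ (fun a => toWeakSpace ℂ E (B.left a x)) ∧
      @Continuous A (WeakSpace ℂ E) (weakStarTopology P) _ (fun a => toWeakSpace ℂ E (B.right a x)) :=
  Iff.rfl

/-- Multiplication in a dual Banach algebra is separately weak-star continuous. -/
lemma IsPredual.weakStar_continuous_mul {P : Submodule ℂ (StrongDual ℂ A)}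
    (hP : (regular A).IsPredual P) (b : A) :
    Continuous[weakStarTopology P, weakStarTopology P] (fun a => a * b) ∧
      Continuous[weakStarTopology P, weakStarTopology P] (fun a => b * a) := by
  let _ := weakStarTopology P
  exact ⟨weakStar_continuous_of_eval P fun φ hφ =>
      weakStar_continuous_eval P (hP.left_mem b φ hφ),
    weakStar_continuous_of_eval P fun φ hφ =>
      weakStar_continuous_eval P (hP.right_mem b φ hφ)⟩

lemma left_mem_sigmaWC {P : Submodule ℂ (StrongDual ℂ A)} (hP : (regular A).IsPredual P)
    (B : BanachBimodule A E) (b : A) (x : E) (hx : x ∈ sigmaWC P B) :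
    B.left b x ∈ sigmaWC P B := by
  let _ := weakStarTopology P
  constructor
  · have h : Continuous fun a => toWeakSpace ℂ E (B.left (a * b) x) :=
      hx.1.comp (hP.weakStar_continuous_mul b).1
    simpa only [B.left_mul] using h
  · have h : Continuous fun a => toWeakSpace ℂ E (B.left b (B.right a x)) :=
      continuous_toWeakSpace_of_eval fun φ =>
        continuous_eval_of_toWeakSpace hx.2 (φ ∘L B.left b)
    simpa only [B.left_right] using h

lemma right_mem_sigmaWC {P : Submodule ℂ (StrongDual ℂ A)} (hP : (regular A).IsPredual P)
    (B : BanachBimodule A E) (b : A) (x : E) (hx : x ∈ sigmaWC P B) :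
    B.right b x ∈ sigmaWC P B := by
  let _ := weakStarTopology P
  constructor
  · have h : Continuous fun a => toWeakSpace ℂ E (B.right b (B.left a x)) :=
      continuous_toWeakSpace_of_eval fun φ =>
        continuous_eval_of_toWeakSpace hx.1 (φ ∘L B.right b)
    simpa only [B.left_right] using h
  · have h : Continuous fun a => toWeakSpace ℂ E (B.right (b * a) x) :=
      hx.2.comp (hP.weakStar_continuous_mul b).2
    simpa only [B.right_mul] using h

/-- `σwc(E)` as a sub-bimodule of `E`. -/
def sigmaWCModule {P : Submodule ℂ (StrongDual ℂ A)} (hP : (regular A).IsPredual P)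
    (B : BanachBimodule A E) : BanachBimodule A (sigmaWC P B) :=
  B.restrict (sigmaWC P B) (left_mem_sigmaWC hP B) (right_mem_sigmaWC hP B)

end BanachBimodule

/-! ### Pointwise Connes amenability -/

section PointwiseConnes

variable {A : Type u} [NormedRing A] [NormedAlgebra ℂ A]

/-- The dual Banach algebra `A` with predual `P` is pointwise Connes amenable at `a₀`: each
weak-star continuous derivation `D` from `A` into a normal dual Banach `A`-bimodule `E` satisfies
`D(a₀) = a₀ · x - x · a₀` for some `x ∈ E`. -/
def PointwiseConnesAmenableAt (P : Submodule ℂ (StrongDual ℂ A)) (a₀ : A) : Prop :=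
  ∀ (E : Type u) [NormedAddCommGroup E] [NormedSpace ℂ E] [CompleteSpace E]
    (B : BanachBimodule A E) (Q : Submodule ℂ (StrongDual ℂ E)),
    B.IsPredual Q → B.IsNormal P Q →
    ∀ D : A →L[ℂ] E, B.IsDerivation D →
      Continuous[weakStarTopology P, weakStarTopology Q] D →
      ∃ x : E, D a₀ = B.left a₀ x - B.right a₀ x

/-- Pointwise Connes amenability: at each element of `A`. -/
def PointwiseConnesAmenable (P : Submodule ℂ (StrongDual ℂ A)) : Prop :=
  ∀ a₀ : A, PointwiseConnesAmenableAt P a₀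

end PointwiseConnes

/-! ### The diagonal maps -/

section Diagonal

open BanachBimodule

variable {A : Type*} [NormedRing A] [NormedAlgebra ℂ A] [CompleteSpace A]

variable (A) in
/-- The multiplication map `π : A ⊗̂ A → A`, `π(a ⊗ b) = ab`. -/
def diagMap : ProjTensor A A →L[ℂ] A := ProjTensor.lift (ContinuousLinearMap.mul ℂ A)

@[simp] lemma diagMap_tmul (a b : A) : diagMap A (ProjTensor.tmul a b) = a * b := by
  simp [diagMap]

lemma diagMap_left (a : A) (u : ProjTensor A A) :
    diagMap A ((tensorSquare A).left a u) = a * diagMap A u := by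
  refine DFunLike.congr_fun (f := diagMap A ∘L (tensorSquare A).left a)
    (g := ContinuousLinearMap.mul ℂ A a ∘L diagMap A) (ProjTensor.clm_ext fun c d => ?_) u
  simp [mul_assoc]

lemma diagMap_right (a : A) (u : ProjTensor A A) :
    diagMap A ((tensorSquare A).right a u) = diagMap A u * a := by
  refine DFunLike.congr_fun (f := diagMap A ∘L (tensorSquare A).right a)
    (g := (ContinuousLinearMap.mul ℂ A).flip a ∘L diagMap A) (ProjTensor.clm_ext fun c d => ?_) u
  simp [mul_assoc]

/-- A predual `A_*` of `A` is contained in `σwc(A*)`. -/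
lemma predual_le_sigmaWC {P : Submodule ℂ (StrongDual ℂ A)} (hP : (regular A).IsPredual P)
    {φ : StrongDual ℂ A} (hφ : φ ∈ P) : φ ∈ sigmaWC P (regular A).dual := by
  let _ := weakStarTopology P
  constructor
  · refine continuous_toWeakSpace_of_eval fun Ψ => ?_
    obtain ⟨b, hb⟩ := hP.bijective.2 (Ψ ∘L P.subtypeL)
    have h : ∀ a, Ψ ((regular A).dual.left a φ) = φ (b * a) := fun a =>
      (DFunLike.congr_fun hb ⟨_, hP.left_mem a φ hφ⟩).symm
    simpa only [h] using! weakStar_continuous_eval P (hP.right_mem b φ hφ)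
  · refine continuous_toWeakSpace_of_eval fun Ψ => ?_
    obtain ⟨b, hb⟩ := hP.bijective.2 (Ψ ∘L P.subtypeL)
    have h : ∀ a, Ψ ((regular A).dual.right a φ) = φ (a * b) := fun a =>
      (DFunLike.congr_fun hb ⟨_, hP.right_mem a φ hφ⟩).symm
    simpa only [h] using! weakStar_continuous_eval P (hP.left_mem b φ hφ)

/-- `π*` maps `A_*` into `σwc((A ⊗̂ A)*)`. -/
lemma adjoint_diagMap_mem_sigmaWC {P : Submodule ℂ (StrongDual ℂ A)}
    (hP : (regular A).IsPredual P) {φ : StrongDual ℂ A} (hφ : φ ∈ P) :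
    adjointMap (diagMap A) φ ∈ sigmaWC P (tensorSquare A).dual := by
  let _ := weakStarTopology P
  have hl : ∀ a, (tensorSquare A).dual.left a (adjointMap (diagMap A) φ) =
      adjointMap (diagMap A) ((regular A).dual.left a φ) := fun a => by
    ext u; simp [diagMap_right]
  have hr : ∀ a, (tensorSquare A).dual.right a (adjointMap (diagMap A) φ) =
      adjointMap (diagMap A) ((regular A).dual.right a φ) := fun a => by
    ext u; simp [diagMap_left]
  have h := predual_le_sigmaWC hP hφ
  constructor
  · simp only [hl]
    exact continuous_toWeakSpace_of_eval fun Ψ =>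
      continuous_eval_of_toWeakSpace h.1 (Ψ ∘L adjointMap (diagMap A))
  · simp only [hr]
    exact continuous_toWeakSpace_of_eval fun Ψ =>
      continuous_eval_of_toWeakSpace h.2 (Ψ ∘L adjointMap (diagMap A))

/-- The restriction of `π*` to a map `A_* → σwc((A ⊗̂ A)*)`. -/
def adjointDiagRestrict {P : Submodule ℂ (StrongDual ℂ A)} (hP : (regular A).IsPredual P) :
    P →L[ℂ] sigmaWC P (tensorSquare A).dual :=
  (adjointMap (diagMap A) ∘L P.subtypeL).codRestrict _
    fun φ => adjoint_diagMap_mem_sigmaWC hP φ.2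

/-- `π_σwc : σwc((A ⊗̂ A)*)* → (A_*)* = A`, the adjoint of the restriction of `π*` to `A_*`. -/
def diagSigmaWC {P : Submodule ℂ (StrongDual ℂ A)} (hP : (regular A).IsPredual P) :
    StrongDual ℂ (sigmaWC P (tensorSquare A).dual) →L[ℂ] A :=
  (hP.equiv.symm : StrongDual ℂ P →L[ℂ] A) ∘L adjointMap (adjointDiagRestrict hP)

lemma diagSigmaWC_spec {P : Submodule ℂ (StrongDual ℂ A)} (hP : (regular A).IsPredual P)
    (M : StrongDual ℂ (sigmaWC P (tensorSquare A).dual)) (φ : P) :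
    (φ : StrongDual ℂ A) (diagSigmaWC hP M) = M (adjointDiagRestrict hP φ) := by
  rw [← hP.equiv_apply]
  simp [diagSigmaWC]

/-- The canonical map `ι : A_* → (A_*)** = A*`. -/
def iotaPredual {P : Submodule ℂ (StrongDual ℂ A)} (hP : (regular A).IsPredual P) :
    P →L[ℂ] StrongDual ℂ A :=
  adjointMap (hP.equiv : A →L[ℂ] StrongDual ℂ P) ∘L NormedSpace.inclusionInDoubleDual ℂ P

lemma iotaPredual_apply {P : Submodule ℂ (StrongDual ℂ A)} (hP : (regular A).IsPredual P)
    (φ : P) : iotaPredual hP φ = (φ : StrongDual ℂ A) := rfl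

/-- The adjoint `ι* : A** → (A_*)* = A` of the canonical map. -/
def iotaStar {P : Submodule ℂ (StrongDual ℂ A)} (hP : (regular A).IsPredual P) :
    StrongDual ℂ (StrongDual ℂ A) →L[ℂ] A :=
  (hP.equiv.symm : StrongDual ℂ P →L[ℂ] A) ∘L adjointMap (iotaPredual hP)

variable (A) in
/-- The identification `L(A, A*) = (A ⊗̂ A)*`: `⟨b ⊗ c, T⟩ = ⟨b, T(c)⟩`. -/
def homDualEquiv : (A →L[ℂ] StrongDual ℂ A) ≃L[ℂ] StrongDual ℂ (ProjTensor A A) :=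
  ContinuousLinearEquiv.equivOfInverse
    (ProjTensor.lift ∘L (ContinuousLinearMap.flipₗᵢ ℂ A A ℂ).toLinearIsometry.toContinuousLinearMap)
    ((ContinuousLinearMap.flipₗᵢ ℂ A A ℂ).toLinearIsometry.toContinuousLinearMap ∘L
      ((ContinuousLinearMap.compL ℂ A (A →L[ℂ] ProjTensor A A) (A →L[ℂ] ℂ)).flip
        ProjTensor.tmul) ∘L ContinuousLinearMap.compL ℂ A (ProjTensor A A) ℂ)
    (fun T => by ext b c; simp)
    (fun f => ProjTensor.clm_ext fun b c => by simp)

@[simp] lemma homDualEquiv_tmul (T : A →L[ℂ] StrongDual ℂ A) (b c : A) :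
    homDualEquiv A T (ProjTensor.tmul b c) = T c b := by
  simp [homDualEquiv]

lemma homDualEquiv_left (a : A) (T : A →L[ℂ] StrongDual ℂ A) :
    homDualEquiv A ((homDual A).left a T) = (tensorSquare A).dual.left a (homDualEquiv A T) :=
  ProjTensor.clm_ext fun b c => by simp

lemma homDualEquiv_right (a : A) (T : A →L[ℂ] StrongDual ℂ A) :
    homDualEquiv A ((homDual A).right a T) = (tensorSquare A).dual.right a (homDualEquiv A T) :=
  ProjTensor.clm_ext fun b c => by simp

end Diagonal

end

/-! Write `F = σwc((A ⊗̂ A)*)`, a bimodule all of whose elements have coefficient functionals in the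
predual `P`.

From amenability to a diagonal: the functional `u` on `F` given by `1 ⊗ 1` satisfies `π_σwc(u) = 1`,
and `a · u - u · a` comes from `a ⊗ 1 - 1 ⊗ a`, which multiplication kills. So `a ↦ a · u - u · a`
is a derivation into `ker π_σwc`. This kernel is a weak-star closed submodule of `F*`, hence a dual
bimodule, and it is normal because `σwc(F) = F`. Amenability at `a` gives `x` in the kernel with `a
· u - u · a = a · x - x · a`, and `M = u - x` is the required functional
(`exists_commuting_of_amenableAt`, `exists_sigmaWC_diagonal`).

From a diagonal to amenability: for a weak-star continuous derivation `D` and `q` in the predual of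
`E`, let `Φ_q(b ⊗ c) = q(b · D(c))`. These functionals lie in `F` (`tensorCoeff_mem_sigmaWC`), so `q
↦ M(Φ_q)` is evaluation at some `x ∈ E`. The derivation rule gives `a · Φ_q = Φ_{a·q} + π*(b ↦ q(b ·
D(a)))` and `Φ_q · a = Φ_{q·a}`. Since `M` commutes with `a` and `π_σwc(M) = 1`, it follows that `1
· D(a) = a · x - x · a`. As `E` need not be unital, the remaining part of `D(a)` is treated
algebraically, using `D(1)` (`IsDerivation.exists_eq_inner`).

The second equivalence follows from the first by Hahn–Banach: functionals on `F` are the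
restrictions of elements of `(A ⊗̂ A)**`. -/

/-! ### Weak-star continuity as membership in the predual -/

section WeakStarFunctionals

variable {E : Type*} [NormedAddCommGroup E] [NormedSpace ℂ E]

/-- A bounded functional lies in `P` if and only if it is `σ(E, P)`-continuous. -/
lemma mem_iff_weakStar_continuous (P : Submodule ℂ (StrongDual ℂ E)) (φ : StrongDual ℂ E) :
    φ ∈ P ↔ @Continuous E ℂ (weakStarTopology P) _ (fun x => φ x) := by
  refine ⟨weakStar_continuous_eval P, fun h => ?_⟩
  let b : E →ₗ[ℂ] P →ₗ[ℂ] ℂ := (evalPredual P).toLinearMap₁₂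
  -- The topology of `WeakBilin b` is by definition `σ(E, P)`, so `h` itself is the required
  -- continuity; the dual of `E` for this topology is `P`.
  let g : StrongDual ℂ (WeakBilin b) := ⟨φ.toLinearMap, h⟩
  obtain ⟨ψ, hψ⟩ := LinearMap.dualEmbedding_surjective b g
  have hφ : φ = ψ := by
    ext x
    exact (DFunLike.congr_fun hψ x).symm
  exact hφ ▸ ψ.2

end WeakStarFunctionals

namespace BanachBimodule

variable {A : Type*} [NormedRing A] [NormedAlgebra ℂ A]
  {E : Type*} [NormedAddCommGroup E] [NormedSpace ℂ E]
  {P : Submodule ℂ (StrongDual ℂ A)} {B : BanachBimodule A E}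

/-- `x ∈ σwc(E)` if and only if all coefficient functionals of `x` lie in the predual. -/
lemma mem_sigmaWC_iff_coeff_mem {x : E} : x ∈ sigmaWC P B ↔
    ∀ ψ : StrongDual ℂ E, ψ ∘L B.left.flip x ∈ P ∧ ψ ∘L B.right.flip x ∈ P := by
  let _ := weakStarTopology P
  refine ⟨fun h ψ => ?_, fun h => ⟨?_, ?_⟩⟩
  · rw [mem_iff_weakStar_continuous, mem_iff_weakStar_continuous]
    exact ⟨continuous_eval_of_toWeakSpace h.1 ψ, continuous_eval_of_toWeakSpace h.2 ψ⟩
  · exact continuous_toWeakSpace_of_eval fun ψ => weakStar_continuous_eval P (h ψ).1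
  · exact continuous_toWeakSpace_of_eval fun ψ => weakStar_continuous_eval P (h ψ).2

/-- A map into `E` is continuous for `σ(E, Q)` exactly when its composites with all `q ∈ Q` are.
This form turns normality into linear conditions that pass to closures, as `P` is closed in the
applications. -/
lemma isNormal_iff_coeff_mem {Q : Submodule ℂ (StrongDual ℂ E)} : B.IsNormal P Q ↔
    ∀ x, ∀ q ∈ Q, q ∘L B.left.flip x ∈ P ∧ q ∘L B.right.flip x ∈ P := by
  let _ := weakStarTopology P
  refine ⟨fun h x q hq => ?_, fun h x => ⟨?_, ?_⟩⟩
  · rw [mem_iff_weakStar_continuous, mem_iff_weakStar_continuous]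
    exact ⟨@Continuous.comp _ _ _ _ (weakStarTopology Q) _ _ _ (weakStar_continuous_eval Q hq) (h x).1,
      @Continuous.comp _ _ _ _ (weakStarTopology Q) _ _ _ (weakStar_continuous_eval Q hq) (h x).2⟩
  · exact weakStar_continuous_of_eval Q fun q hq => weakStar_continuous_eval P (h x q hq).1
  · exact weakStar_continuous_of_eval Q fun q hq => weakStar_continuous_eval P (h x q hq).2

end BanachBimodule

lemma weakStar_continuous_iff_comp_mem {E F : Type*} [NormedAddCommGroup E] [NormedSpace ℂ E]
    [NormedAddCommGroup F] [NormedSpace ℂ F] {P : Submodule ℂ (StrongDual ℂ E)}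
    {Q : Submodule ℂ (StrongDual ℂ F)} {D : E →L[ℂ] F} :
    Continuous[weakStarTopology P, weakStarTopology Q] D ↔ ∀ q ∈ Q, q ∘L D ∈ P := by
  let _ := weakStarTopology P
  refine ⟨fun h q hq => ?_, fun h => ?_⟩
  · rw [mem_iff_weakStar_continuous]
    exact @Continuous.comp _ _ _ _ (weakStarTopology Q) _ _ _ (weakStar_continuous_eval Q hq) h
  · exact weakStar_continuous_of_eval Q fun q hq => weakStar_continuous_eval P (h q hq)

/-! ### Weak-star closed subspaces of a dual space -/

section KernelPredual

variable {F G : Type*} [NormedAddCommGroup F] [NormedSpace ℂ F]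
  [NormedAddCommGroup G] [NormedSpace ℂ G]

/-- The map `F → S*`, `v ↦ (M ↦ M v)`, for a space `S ⊆ F*`. -/
noncomputable def evalOn (S : Submodule ℂ (StrongDual ℂ F)) : F →L[ℂ] StrongDual ℂ S :=
  adjointMap S.subtypeL ∘L NormedSpace.inclusionInDoubleDual ℂ F

@[simp]
lemma evalOn_apply (S : Submodule ℂ (StrongDual ℂ F)) (v : F) (M : S) :
    evalOn S v M = (M : StrongDual ℂ F) v := rfl

/-- The closed space of functionals on `S ⊆ F*` spanned by the evaluations at points of `F`. -/
noncomputable def evalClosure (S : Submodule ℂ (StrongDual ℂ F)) : Submodule ℂ (StrongDual ℂ S) :=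
  (evalOn S).range.topologicalClosure

lemma evalOn_mem_evalClosure (S : Submodule ℂ (StrongDual ℂ F)) (v : F) :
    evalOn S v ∈ evalClosure S :=
  Submodule.le_topologicalClosure _ ⟨v, rfl⟩

/-- A bounded linear map sends `evalClosure S` to a closed space `T` if it does so for point
evaluations. -/
lemma evalClosure_map_mem {S : Submodule ℂ (StrongDual ℂ F)} {T : Submodule ℂ G}
    (hT : IsClosed (T : Set G)) (f : StrongDual ℂ S →L[ℂ] G) (h : ∀ v, f (evalOn S v) ∈ T)
    {q : StrongDual ℂ S} (hq : q ∈ evalClosure S) : f q ∈ T := by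
  have hle : evalClosure S ≤ T.comap f.toLinearMap := by
    refine Submodule.topologicalClosure_minimal _ ?_ (hT.preimage f.continuous)
    rintro _ ⟨v, rfl⟩
    exact h v
  exact hle hq

/-- The kernel of `f*` is the annihilator of the range of `f`, so a functional on `F` that is
obtained by testing against point evaluations of the kernel falls back into the kernel. -/
lemma bijective_evalPredual_evalClosure_ker (f : G →L[ℂ] F) :
    Function.Bijective (evalPredual (evalClosure (adjointMap f).ker)) := by
  set S := (adjointMap f).ker
  constructor
  · intro M N h
    ext v
    exact DFunLike.congr_fun h ⟨evalOn S v, evalOn_mem_evalClosure S v⟩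
  · intro Ψ
    -- Hahn–Banach extends `Ψ` to all of `S*`; composing with `v ↦ evalOn S v` gives the candidate
    -- preimage in `F*`.
    obtain ⟨Ψ', hΨ', -⟩ := exists_extension_norm_eq (evalClosure S) Ψ
    have hM : Ψ' ∘L evalOn S ∈ S := by
      refine LinearMap.mem_ker.2 ?_
      ext g
      have h0 : evalOn S (f g) = 0 := by
        ext M
        exact DFunLike.congr_fun (LinearMap.mem_ker.1 M.2) g
      simp [h0]
    refine ⟨⟨_, hM⟩, ?_⟩
    ext q
    rw [← hΨ' q, evalPredual_apply]
    -- Evaluation at the candidate and `Ψ'` agree at point evaluations; since `{0}` is closed, their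
    -- difference vanishes on the closure too.
    have h := evalClosure_map_mem (T := ⊥) (by simp)
      (NormedSpace.inclusionInDoubleDual ℂ S ⟨_, hM⟩ - Ψ')
      (fun v => by simp) q.2
    simpa [sub_eq_zero] using h

end KernelPredual

/-! ### Weak-star closed submodules as normal dual bimodules -/

namespace BanachBimodule

variable {A : Type*} [NormedRing A] [NormedAlgebra ℂ A]
  {F G : Type*} [NormedAddCommGroup F] [NormedSpace ℂ F]
  [NormedAddCommGroup G] [NormedSpace ℂ G]

/-- A weak-star closed submodule of a dual bimodule is a dual bimodule. -/
lemma isPredual_restrict_dual (B : BanachBimodule A F) (f : G →L[ℂ] F)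
    (hl : ∀ a, ∀ M ∈ (adjointMap f).ker, B.dual.left a M ∈ (adjointMap f).ker)
    (hr : ∀ a, ∀ M ∈ (adjointMap f).ker, B.dual.right a M ∈ (adjointMap f).ker) :
    (B.dual.restrict (adjointMap f).ker hl hr).IsPredual (evalClosure (adjointMap f).ker) where
  isClosed := Submodule.isClosed_topologicalClosure _
  left_mem a _ hq := evalClosure_map_mem (Submodule.isClosed_topologicalClosure _)
    ((B.dual.restrict _ hl hr).dual.left a) (fun v => evalOn_mem_evalClosure _ (B.left a v)) hq
  right_mem a _ hq := evalClosure_map_mem (Submodule.isClosed_topologicalClosure _)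
    ((B.dual.restrict _ hl hr).dual.right a) (fun v => evalOn_mem_evalClosure _ (B.right a v)) hq
  bijective := bijective_evalPredual_evalClosure_ker f

/-- If `σwc(F) = F` then the weak-star closed submodules of `F*` are normal. -/
lemma isNormal_restrict_dual {P : Submodule ℂ (StrongDual ℂ A)} (hP : IsClosed (P : Set (StrongDual ℂ A)))
    (B : BanachBimodule A F) (hB : ∀ v, v ∈ sigmaWC P B) (S : Submodule ℂ (StrongDual ℂ F))
    (hl : ∀ a, ∀ M ∈ S, B.dual.left a M ∈ S) (hr : ∀ a, ∀ M ∈ S, B.dual.right a M ∈ S) :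
    (B.dual.restrict S hl hr).IsNormal P (evalClosure S) := by
  refine isNormal_iff_coeff_mem.2 fun M q hq => ⟨?_, ?_⟩
  -- It suffices to test at point evaluations, because `P` is closed. As `(a · M)(v) = M(v · a)`,
  -- left coefficients of `M` are right coefficients of `v`, and conversely.
  · exact evalClosure_map_mem hP (adjointMap ((B.dual.restrict S hl hr).left.flip M))
      (fun v => (mem_sigmaWC_iff_coeff_mem.1 (hB v) M).2) hq
  · exact evalClosure_map_mem hP (adjointMap ((B.dual.restrict S hl hr).right.flip M))
      (fun v => (mem_sigmaWC_iff_coeff_mem.1 (hB v) M).1) hq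

/-- Every element of the bimodule `σwc(E)` is weak-star to weakly continuous in `σwc(E)`. -/
lemma mem_sigmaWC_sigmaWCModule {P : Submodule ℂ (StrongDual ℂ A)} (hP : (regular A).IsPredual P)
    (B : BanachBimodule A F) (v : sigmaWC P B) : v ∈ sigmaWC P (sigmaWCModule hP B) := by
  refine mem_sigmaWC_iff_coeff_mem.2 fun ψ => ?_
  -- A functional on `σwc(E)` extends to `E` by Hahn–Banach, and the extension has the same
  -- coefficients at `v`.
  obtain ⟨ψ', h, -⟩ := exists_extension_norm_eq (sigmaWC P B) ψ
  obtain ⟨h1, h2⟩ := mem_sigmaWC_iff_coeff_mem.1 v.2 ψ'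
  constructor
  · convert h1 using 1
    ext a
    exact (h _).symm
  · convert h2 using 1
    ext a
    exact (h _).symm

/-! ### Preduals and inner derivations -/

section Predual

variable {A : Type*} [NormedRing A] [NormedAlgebra ℂ A]
  {E : Type*} [NormedAddCommGroup E] [NormedSpace ℂ E]
  {B : BanachBimodule A E} {Q : Submodule ℂ (StrongDual ℂ E)}

lemma IsPredual.eq_of_forall_eq (hQ : B.IsPredual Q) {x y : E} (h : ∀ q ∈ Q, q x = q y) :
    x = y :=
  hQ.bijective.1 (by ext q; exact h q q.2)

lemma IsPredual.exists_eq_eval (hQ : B.IsPredual Q) (Ψ : StrongDual ℂ Q) :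
    ∃ x : E, ∀ q : Q, (q : StrongDual ℂ E) x = Ψ q := by
  obtain ⟨x, hx⟩ := hQ.bijective.2 Ψ
  exact ⟨x, fun q => DFunLike.congr_fun hx q⟩

/-- The inner derivation `a ↦ a · x - x · a`. -/
noncomputable def inner (B : BanachBimodule A E) (x : E) : A →L[ℂ] E :=
  B.left.flip x - B.right.flip x

@[simp]
lemma inner_apply (B : BanachBimodule A E) (x : E) (a : A) :
    B.inner x a = B.left a x - B.right a x := rfl

lemma isDerivation_inner (B : BanachBimodule A E) (x : E) : B.IsDerivation (B.inner x) :=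
  fun a b => by simp [B.left_mul, B.right_mul, B.left_right]

end Predual

/-! ### From amenability to virtual diagonals -/

section Forward

variable {A : Type*} [NormedRing A] [NormedAlgebra ℂ A] [CompleteSpace A]
  {P : Submodule ℂ (StrongDual ℂ A)} (hP : (regular A).IsPredual P)

lemma sigmaWCModule_right_adjointDiagRestrict (a : A) (φ : P) :
    (sigmaWCModule hP (tensorSquare A).dual).right a (adjointDiagRestrict hP φ) =
      adjointDiagRestrict hP ⟨_, hP.right_mem a φ φ.2⟩ := by
  refine Subtype.ext ?_
  ext u
  exact congrArg (φ : StrongDual ℂ A) (diagMap_left a u)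

lemma sigmaWCModule_left_adjointDiagRestrict (a : A) (φ : P) :
    (sigmaWCModule hP (tensorSquare A).dual).left a (adjointDiagRestrict hP φ) =
      adjointDiagRestrict hP ⟨_, hP.left_mem a φ φ.2⟩ := by
  refine Subtype.ext ?_
  ext u
  exact congrArg (φ : StrongDual ℂ A) (diagMap_right a u)

/-- Since `π*` intertwines the actions, its range on `P` is stable under them, and so is the
annihilator of that range, which is the kernel of `π_σwc`. -/
lemma left_mem_ker_adjointDiagRestrict (a : A)
    (M : StrongDual ℂ (sigmaWC P (tensorSquare A).dual))
    (hM : M ∈ (adjointMap (adjointDiagRestrict hP)).ker) :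
    (sigmaWCModule hP (tensorSquare A).dual).dual.left a M ∈
      (adjointMap (adjointDiagRestrict hP)).ker := by
  refine LinearMap.mem_ker.2 ?_
  ext φ
  exact (congrArg M (sigmaWCModule_right_adjointDiagRestrict hP a φ)).trans
    (DFunLike.congr_fun (LinearMap.mem_ker.1 hM) _)

lemma right_mem_ker_adjointDiagRestrict (a : A)
    (M : StrongDual ℂ (sigmaWC P (tensorSquare A).dual))
    (hM : M ∈ (adjointMap (adjointDiagRestrict hP)).ker) :
    (sigmaWCModule hP (tensorSquare A).dual).dual.right a M ∈
      (adjointMap (adjointDiagRestrict hP)).ker := by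
  refine LinearMap.mem_ker.2 ?_
  ext φ
  exact (congrArg M (sigmaWCModule_left_adjointDiagRestrict hP a φ)).trans
    (DFunLike.congr_fun (LinearMap.mem_ker.1 hM) _)

variable (P) in
/-- Evaluation at `1 ⊗ 1`, as a functional on `σwc((A ⊗̂ A)*)`. -/
noncomputable def unitTensorEval : StrongDual ℂ (sigmaWC P (tensorSquare A).dual) :=
  NormedSpace.inclusionInDoubleDual ℂ (ProjTensor A A) (ProjTensor.tmul 1 1) ∘L
    (sigmaWC P (tensorSquare A).dual).subtypeL

@[simp]
lemma unitTensorEval_apply (v : sigmaWC P (tensorSquare A).dual) :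
    unitTensorEval P v = (v : StrongDual ℂ (ProjTensor A A)) (ProjTensor.tmul 1 1) := rfl

lemma unitTensorEval_adjointDiagRestrict (φ : P) :
    unitTensorEval P (adjointDiagRestrict hP φ) = (φ : StrongDual ℂ A) 1 :=
  congrArg (φ : StrongDual ℂ A) (by simp)

/-- Tested on `π*(φ)`, both `a · (1 ⊗ 1)` and `(1 ⊗ 1) · a` give `φ(a)`. -/
lemma inner_unitTensorEval_mem_ker (a : A) :
    (sigmaWCModule hP (tensorSquare A).dual).dual.inner (unitTensorEval P) a ∈
      (adjointMap (adjointDiagRestrict hP)).ker := by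
  refine LinearMap.mem_ker.2 ?_
  ext φ
  have h : unitTensorEval P ((sigmaWCModule hP (tensorSquare A).dual).right a
      (adjointDiagRestrict hP φ)) = unitTensorEval P
      ((sigmaWCModule hP (tensorSquare A).dual).left a (adjointDiagRestrict hP φ)) := by
    rw [sigmaWCModule_right_adjointDiagRestrict, sigmaWCModule_left_adjointDiagRestrict,
      unitTensorEval_adjointDiagRestrict, unitTensorEval_adjointDiagRestrict]
    simp
  exact sub_eq_zero.2 h

end Forward

/-- If all of `F` is weak-star to weakly continuous, `ker f* ⊆ F*` is a submodule and the inner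
derivation given by `M ∈ F*` has values in it, then amenability at `a` allows one to correct `M`
by an element of `ker f*` to a functional commuting with `a`. -/
lemma exists_commuting_of_amenableAt {A F : Type u} {G : Type*} [NormedRing A]
    [NormedAlgebra ℂ A] [NormedAddCommGroup F] [NormedSpace ℂ F] [NormedAddCommGroup G]
    [NormedSpace ℂ G] {P : Submodule ℂ (StrongDual ℂ A)} (hP : IsClosed (P : Set (StrongDual ℂ A)))
    {a : A} (h : PointwiseConnesAmenableAt P a) (B : BanachBimodule A F)
    (hB : ∀ v, v ∈ sigmaWC P B) (f : G →L[ℂ] F)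
    (hl : ∀ b, ∀ M ∈ (adjointMap f).ker, B.dual.left b M ∈ (adjointMap f).ker)
    (hr : ∀ b, ∀ M ∈ (adjointMap f).ker, B.dual.right b M ∈ (adjointMap f).ker)
    (M : StrongDual ℂ F) (hM : ∀ b, B.dual.inner M b ∈ (adjointMap f).ker) :
    ∃ x : StrongDual ℂ F, x ∈ (adjointMap f).ker ∧
      B.dual.left a (M - x) = B.dual.right a (M - x) := by
  have hclosed : IsClosed ((adjointMap f).ker : Set (StrongDual ℂ F)) :=
    (adjointMap f).isClosed_ker
  have : CompleteSpace (adjointMap f).ker := hclosed.completeSpace_coe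
  let D : A →L[ℂ] (adjointMap f).ker := (B.dual.inner M).codRestrict _ hM
  have hD : (B.dual.restrict _ hl hr).IsDerivation D := fun b c =>
    Subtype.ext (B.dual.isDerivation_inner M b c)
  -- At a point evaluation `v`, the composite is `b ↦ M(v · b) - M(b · v)`, a difference of two
  -- coefficients of `v`, both in `P`.
  have hcont : ∀ q ∈ evalClosure (adjointMap f).ker, q ∘L D ∈ P := fun q hq =>
    evalClosure_map_mem hP (adjointMap D) (fun v => by
      obtain ⟨h1, h2⟩ := mem_sigmaWC_iff_coeff_mem.1 (hB v) M
      exact P.sub_mem h2 h1) hq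
  obtain ⟨x, hx⟩ := h _ _ _ (B.isPredual_restrict_dual f hl hr)
    (isNormal_restrict_dual hP B hB _ hl hr) D hD (weakStar_continuous_iff_comp_mem.2 hcont)
  have hx' : B.dual.left a M - B.dual.right a M = B.dual.left a x - B.dual.right a x :=
    congrArg Subtype.val hx
  refine ⟨x, x.2, ?_⟩
  rw [map_sub, map_sub, ← sub_eq_zero, sub_sub_sub_comm, hx', sub_self]

/-- Pointwise Connes amenability at `a` yields a `σwc`-virtual diagonal commuting with `a`. -/
theorem exists_sigmaWC_diagonal {A : Type u} [NormedRing A] [NormedAlgebra ℂ A] [CompleteSpace A]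
    {P : Submodule ℂ (StrongDual ℂ A)} (hP : (regular A).IsPredual P) {a : A}
    (h : PointwiseConnesAmenableAt P a) :
    ∃ M : StrongDual ℂ (sigmaWC P (tensorSquare A).dual),
      (sigmaWCModule hP (tensorSquare A).dual).dual.left a M =
        (sigmaWCModule hP (tensorSquare A).dual).dual.right a M ∧
      diagSigmaWC hP M = 1 := by
  have hfit := exists_commuting_of_amenableAt (G := P) hP.isClosed h
    (sigmaWCModule hP (tensorSquare A).dual) (mem_sigmaWC_sigmaWCModule hP _)
    (adjointDiagRestrict hP)
  have hmod := hfit (left_mem_ker_adjointDiagRestrict hP) (right_mem_ker_adjointDiagRestrict hP)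
    (unitTensorEval P)
  have hcor := hmod (inner_unitTensorEval_mem_ker hP)
  obtain ⟨x, hx, hcomm⟩ := hcor
  refine ⟨unitTensorEval P - x, hcomm, hP.eq_of_forall_eq fun φ hφ => ?_⟩
  have h0 : x (adjointDiagRestrict hP ⟨φ, hφ⟩) = 0 :=
    DFunLike.congr_fun (LinearMap.mem_ker.1 hx) _
  refine (diagSigmaWC_spec hP _ ⟨φ, hφ⟩).trans ?_
  have h1 := unitTensorEval_adjointDiagRestrict hP ⟨φ, hφ⟩
  have h2 := sub_apply (unitTensorEval P) x (adjointDiagRestrict hP ⟨φ, hφ⟩)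
  rw [h0, h1, sub_zero] at h2
  exact h2

/-! ### From virtual diagonals to amenability -/

section Backward

variable {A : Type*} [NormedRing A] [NormedAlgebra ℂ A]
  {E : Type*} [NormedAddCommGroup E] [NormedSpace ℂ E]

/-- For `D : A → E` the map sending `q ∈ E*` to the functional `b ⊗ c ↦ q(b · D(c))`. -/
noncomputable def tensorCoeff (B : BanachBimodule A E) (D : A →L[ℂ] E) :
    StrongDual ℂ E →L[ℂ] StrongDual ℂ (ProjTensor A A) :=
  ProjTensor.lift ∘L
    (ContinuousLinearMap.compL ℂ A (StrongDual ℂ E) (StrongDual ℂ A) (adjointMap D)) ∘L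
    ((ContinuousLinearMap.compL ℂ A (E →L[ℂ] E) (StrongDual ℂ E)).flip B.left) ∘L
    ContinuousLinearMap.compL ℂ E E ℂ

@[simp]
lemma tensorCoeff_tmul (B : BanachBimodule A E) (D : A →L[ℂ] E) (q : StrongDual ℂ E) (b c : A) :
    B.tensorCoeff D q (ProjTensor.tmul b c) = q (B.left b (D c)) := by
  simp [tensorCoeff]

lemma dual_right_tensorCoeff (B : BanachBimodule A E) (D : A →L[ℂ] E) (q : StrongDual ℂ E)
    (a : A) : (tensorSquare A).dual.right a (B.tensorCoeff D q) =
      B.tensorCoeff D (B.dual.right a q) :=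
  ProjTensor.clm_ext fun b c => by simp [B.left_mul]

variable [CompleteSpace A]

/-- The derivation rule splits `q(b · D(ca))` into `q(b · D(c) · a)` and `q(bc · D(a))`; the second
depends only on the product `bc`, hence comes from `π*`. -/
lemma dual_left_tensorCoeff {B : BanachBimodule A E} {D : A →L[ℂ] E} (hD : B.IsDerivation D)
    (q : StrongDual ℂ E) (a : A) : (tensorSquare A).dual.left a (B.tensorCoeff D q) =
      B.tensorCoeff D (B.dual.left a q) + adjointMap (diagMap A) (q ∘L B.left.flip (D a)) :=
  ProjTensor.clm_ext fun b c => by simp [B.left_mul, hD c a, B.left_right]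

/-- Any `Ψ` in the bidual acts on the functionals `Φ_q` as a point `x ∈ E` and on `π*(P)` as an
element `b ∈ A`. Hence `Ψ(a · Φ_q) = q(x · a) + q(b · D(a))` and `Ψ(Φ_q · a) = q(a · x)`. Normality
and the weak-star continuity of `D` put these functions of `a` in `P`. -/
lemma tensorCoeff_mem_sigmaWC {B : BanachBimodule A E} {D : A →L[ℂ] E}
    {P : Submodule ℂ (StrongDual ℂ A)} {Q : Submodule ℂ (StrongDual ℂ E)}
    (hP : (regular A).IsPredual P) (hQ : B.IsPredual Q) (hB : B.IsNormal P Q)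
    (hD : B.IsDerivation D) (hDc : ∀ q ∈ Q, q ∘L D ∈ P) {q : StrongDual ℂ E} (hq : q ∈ Q) :
    B.tensorCoeff D q ∈ sigmaWC P (tensorSquare A).dual := by
  rw [isNormal_iff_coeff_mem] at hB
  refine mem_sigmaWC_iff_coeff_mem.2 fun Ψ => ?_
  obtain ⟨x, hx⟩ := hQ.exists_eq_eval (Ψ ∘L B.tensorCoeff D ∘L Q.subtypeL)
  obtain ⟨b, hb⟩ := hP.exists_eq_eval (Ψ ∘L adjointMap (diagMap A) ∘L P.subtypeL)
  constructor
  · convert P.add_mem (hB x q hq).2 (hDc _ (hQ.right_mem b q hq)) using 1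
    ext a
    have h1 := hx ⟨_, hQ.left_mem a q hq⟩
    have h2 := hb ⟨_, (hB (D a) q hq).1⟩
    simp only [ContinuousLinearMap.comp_apply, Submodule.subtypeL_apply] at h1 h2
    simp only [ContinuousLinearMap.comp_apply, ContinuousLinearMap.flip_apply,
      dual_left_tensorCoeff hD, map_add, add_apply, ← h1, ← h2]
    rfl
  · convert (hB x q hq).1 using 1
    ext a
    have h1 := hx ⟨_, hQ.right_mem a q hq⟩
    simp only [ContinuousLinearMap.comp_apply, Submodule.subtypeL_apply] at h1
    simp only [ContinuousLinearMap.comp_apply, ContinuousLinearMap.flip_apply,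
      dual_right_tensorCoeff, ← h1]
    rfl

/-- A `σwc`-virtual diagonal commuting with `a` makes the unital part of every weak-star
continuous derivation inner at `a`. -/
lemma exists_left_one_eq_inner {B : BanachBimodule A E} {D : A →L[ℂ] E}
    {P : Submodule ℂ (StrongDual ℂ A)} {Q : Submodule ℂ (StrongDual ℂ E)}
    (hP : (regular A).IsPredual P) (hQ : B.IsPredual Q) (hB : B.IsNormal P Q)
    (hD : B.IsDerivation D) (hDc : ∀ q ∈ Q, q ∘L D ∈ P) {a : A}
    {M : StrongDual ℂ (sigmaWC P (tensorSquare A).dual)}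
    (hM : (sigmaWCModule hP (tensorSquare A).dual).dual.left a M =
      (sigmaWCModule hP (tensorSquare A).dual).dual.right a M)
    (hM1 : diagSigmaWC hP M = 1) :
    ∃ x : E, B.left 1 (D a) = B.left a x - B.right a x := by
  have hmem : ∀ q : Q, B.tensorCoeff D q ∈ sigmaWC P (tensorSquare A).dual := fun q =>
    tensorCoeff_mem_sigmaWC hP hQ hB hD hDc q.2
  let T : Q →L[ℂ] sigmaWC P (tensorSquare A).dual :=
    (B.tensorCoeff D ∘L Q.subtypeL).codRestrict _ hmem
  obtain ⟨x, hx⟩ := hQ.exists_eq_eval (M ∘L T)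
  refine ⟨x, hQ.eq_of_forall_eq fun q hq => ?_⟩
  let ψ : P := ⟨q ∘L B.left.flip (D a), (isNormal_iff_coeff_mem.1 hB (D a) q hq).1⟩
  have hr : (sigmaWCModule hP (tensorSquare A).dual).right a (T ⟨q, hq⟩) =
      T ⟨_, hQ.right_mem a q hq⟩ := Subtype.ext (dual_right_tensorCoeff B D q a)
  have hl : (sigmaWCModule hP (tensorSquare A).dual).left a (T ⟨q, hq⟩) =
      T ⟨_, hQ.left_mem a q hq⟩ + adjointDiagRestrict hP ψ :=
    Subtype.ext (dual_left_tensorCoeff hD q a)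
  have key : M ((sigmaWCModule hP (tensorSquare A).dual).right a (T ⟨q, hq⟩)) =
      M ((sigmaWCModule hP (tensorSquare A).dual).left a (T ⟨q, hq⟩)) :=
    DFunLike.congr_fun hM (T ⟨q, hq⟩)
  have h1 : q (B.left a x) = M (T ⟨_, hQ.right_mem a q hq⟩) := hx ⟨_, hQ.right_mem a q hq⟩
  have h2 : q (B.right a x) = M (T ⟨_, hQ.left_mem a q hq⟩) := hx ⟨_, hQ.left_mem a q hq⟩
  have h3 : q (B.left 1 (D a)) = M (adjointDiagRestrict hP ψ) := by
    rw [← diagSigmaWC_spec hP, hM1]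
    rfl
  -- `key` becomes `M(Φ_{q·a}) = M(Φ_{a·q}) + M(π*(ψ))`, that is, `q(a · x) = q(x · a) + q(1 ·
  -- D(a))`.
  rw [hr, hl, map_add] at key
  rw [map_sub, h1, h2, h3, key]
  ring

/-- A derivation is inner at `a` as soon as its unital part `1 · D` is. -/
lemma IsDerivation.exists_eq_inner {B : BanachBimodule A E} {D : A →L[ℂ] E}
    (hD : B.IsDerivation D) {a : A} {x : E} (hx : B.left 1 (D a) = B.left a x - B.right a x) :
    ∃ y : E, D a = B.left a y - B.right a y := by
  have hl : ∀ (b c : A) (z : E), B.left b (B.left c z) = B.left (b * c) z := fun b c z =>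
    (B.left_mul b c z).symm
  have hr : ∀ (b c : A) (z : E), B.right c (B.right b z) = B.right (b * c) z := fun b c z =>
    (B.right_mul b c z).symm
  have h1 : D a = B.right a (D 1) + B.left 1 (D a) := by simpa using hD 1 a
  have h2 : D a = B.right 1 (D a) + B.left a (D 1) := by simpa using hD a 1
  -- Multiplying `D(1) = D(1) · 1 + 1 · D(1)` on the left by `1` leaves `1 · D(1) · 1 = 0`.
  have h0 : B.left 1 (B.right 1 (D 1)) = 0 := by
    have h := congrArg (B.left 1) (hD 1 1)
    simpa [hl] using h
  have ha : B.left a (B.right 1 (D 1)) = 0 := by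
    simpa [hl] using congrArg (B.left a) h0
  have ha' : B.right a (B.left 1 (D 1)) = 0 := by
    simpa [hr, B.left_right] using congrArg (B.right a) h0
  -- Substituting `D(a) · 1 = D(1) · a + a · x · 1 - x · a` into `D(a) = D(a) · 1 + a · D(1)` shows
  -- what `y` must give: the first two terms account for `a · D(1) + D(1) · a`, since `1 · D(1) · 1
  -- = 0`, and `x · 1` for the rest.
  refine ⟨B.left 1 (D 1) - B.right 1 (D 1) + B.right 1 x, ?_⟩
  have h3 := congrArg (B.right 1) h1
  rw [hx, map_add, map_sub, hr, hr, B.left_right, mul_one] at h3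
  simp only [map_add, map_sub, hl, hr, mul_one, one_mul, ha, ha']
  rw [h2, h3]
  abel

end Backward

theorem pointwiseConnesAmenable_iff_exists_sigmaWC_diagonal {A : Type u} [NormedRing A]
    [NormedAlgebra ℂ A] [CompleteSpace A] {P : Submodule ℂ (StrongDual ℂ A)}
    (hP : (regular A).IsPredual P) : PointwiseConnesAmenable P ↔
      ∀ a : A, ∃ M : StrongDual ℂ (sigmaWC P (tensorSquare A).dual),
        (sigmaWCModule hP (tensorSquare A).dual).dual.left a M =
          (sigmaWCModule hP (tensorSquare A).dual).dual.right a M ∧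
        diagSigmaWC hP M = 1 := by
  refine ⟨fun h a => exists_sigmaWC_diagonal hP (h a), fun h a E _ _ _ B Q hQ hB D hD hDc => ?_⟩
  obtain ⟨M, hM, hM1⟩ := h a
  obtain ⟨x, hx⟩ := exists_left_one_eq_inner hP hQ hB hD (weakStar_continuous_iff_comp_mem.1 hDc)
    hM hM1
  exact hD.exists_eq_inner hx

/-! ### Virtual diagonals in the bidual of the tensor square -/

variable {A : Type*} [NormedRing A] [NormedAlgebra ℂ A] [CompleteSpace A]
  {P : Submodule ℂ (StrongDual ℂ A)}

lemma iotaStar_spec (hP : (regular A).IsPredual P) (Ψ : StrongDual ℂ (StrongDual ℂ A)) (φ : P) :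
    (φ : StrongDual ℂ A) (iotaStar hP Ψ) = Ψ φ := by
  rw [← hP.equiv_apply]
  simp [iotaStar, iotaPredual_apply]

/-- An isomorphism of bimodules maps `σwc(E)` onto `σwc(F)`. -/
lemma mem_sigmaWC_iff_of_equiv {E F : Type*} [NormedAddCommGroup E] [NormedSpace ℂ E]
    [NormedAddCommGroup F] [NormedSpace ℂ F] {B : BanachBimodule A E} {C : BanachBimodule A F}
    (e : E ≃L[ℂ] F) (hl : ∀ a x, e (B.left a x) = C.left a (e x))
    (hr : ∀ a x, e (B.right a x) = C.right a (e x)) (x : E) :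
    e x ∈ sigmaWC P C ↔ x ∈ sigmaWC P B := by
  rw [mem_sigmaWC_iff_coeff_mem, mem_sigmaWC_iff_coeff_mem]
  constructor
  · intro h ψ
    convert h (ψ ∘L (e.symm : F →L[ℂ] E)) using 3 <;> ext a
    · simp [← hl]
    · simp [← hr]
  · intro h ψ
    convert h (ψ ∘L (e : E →L[ℂ] F)) using 3 <;> ext a
    · simp [← hl]
    · simp [← hr]

/-- Virtual diagonals on `σwc((A ⊗̂ A)*)` are the restrictions of those on `(A ⊗̂ A)*`. -/
lemma exists_sigmaWC_diagonal_iff (hP : (regular A).IsPredual P) (a : A) :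
    (∃ M : StrongDual ℂ (sigmaWC P (tensorSquare A).dual),
        (sigmaWCModule hP (tensorSquare A).dual).dual.left a M =
          (sigmaWCModule hP (tensorSquare A).dual).dual.right a M ∧
        diagSigmaWC hP M = 1) ↔
      ∃ M : StrongDual ℂ (StrongDual ℂ (ProjTensor A A)),
        (∀ T ∈ sigmaWC P (homDual A),
          ((tensorSquare A).dual.dual.left a M - (tensorSquare A).dual.dual.right a M)
            (homDualEquiv A T) = 0) ∧
        iotaStar hP (adjointMap (adjointMap (diagMap A)) M) = 1 := by
  have hmem := mem_sigmaWC_iff_of_equiv (P := P) (homDualEquiv A) homDualEquiv_left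
    homDualEquiv_right
  have hdiag : ∀ (M : StrongDual ℂ (sigmaWC P (tensorSquare A).dual))
      (N : StrongDual ℂ (StrongDual ℂ (ProjTensor A A))), (∀ v : sigmaWC P (tensorSquare A).dual, N v = M v) →
      diagSigmaWC hP M = iotaStar hP (adjointMap (adjointMap (diagMap A)) N) := fun M N h =>
    hP.eq_of_forall_eq fun φ hφ => by
      rw [diagSigmaWC_spec hP M ⟨φ, hφ⟩, iotaStar_spec hP _ ⟨φ, hφ⟩, ← h]
      rfl
  constructor
  · rintro ⟨M, hM, hM1⟩
    obtain ⟨N, hN, -⟩ := exists_extension_norm_eq (sigmaWC P (tensorSquare A).dual) M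
    refine ⟨N, fun T hT => sub_eq_zero.2 ?_, (hdiag M N hN).symm.trans hM1⟩
    let v : sigmaWC P (tensorSquare A).dual := ⟨homDualEquiv A T, (hmem T).2 hT⟩
    -- Both translates of `v` stay in `σwc`, where `N` agrees with `M`, so `N` inherits the
    -- commutation there.
    exact (hN ((sigmaWCModule hP _).right a v)).trans
      ((DFunLike.congr_fun hM v).trans (hN ((sigmaWCModule hP _).left a v)).symm)
  · rintro ⟨N, hN, hN1⟩
    let M : StrongDual ℂ (sigmaWC P (tensorSquare A).dual) :=
      N ∘L (sigmaWC P (tensorSquare A).dual).subtypeL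
    refine ⟨M, ContinuousLinearMap.ext fun v => ?_, (hdiag M N fun v => rfl).trans hN1⟩
    have hT := (homDualEquiv A).apply_symm_apply (v : StrongDual ℂ (ProjTensor A A))
    have h := hN _ ((hmem _).1 (hT.symm ▸ v.2))
    rw [hT, sub_apply, sub_eq_zero, dual_left, dual_right] at h
    exact h

end BanachBimodule

open BanachBimodule in
theorem theorem4p2 {A : Type u} [NormedRing A] [NormedAlgebra ℂ A] [CompleteSpace A]
    (P : Submodule ℂ (StrongDual ℂ A)) (hP : (regular A).IsPredual P) :
    (PointwiseConnesAmenable P ↔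
      ∀ a : A, ∃ M : StrongDual ℂ (sigmaWC P (tensorSquare A).dual),
        (sigmaWCModule hP (tensorSquare A).dual).dual.left a M =
          (sigmaWCModule hP (tensorSquare A).dual).dual.right a M ∧
        diagSigmaWC hP M = 1) ∧
    (PointwiseConnesAmenable P ↔
      ∀ a : A, ∃ M : StrongDual ℂ (StrongDual ℂ (ProjTensor A A)),
        (∀ T ∈ sigmaWC P (homDual A),
          ((tensorSquare A).dual.dual.left a M - (tensorSquare A).dual.dual.right a M)
            (homDualEquiv A T) = 0) ∧
        iotaStar hP (adjointMap (adjointMap (diagMap A)) M) = 1) :=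
  ⟨pointwiseConnesAmenable_iff_exists_sigmaWC_diagonal hP,
    (pointwiseConnesAmenable_iff_exists_sigmaWC_diagonal hP).trans
      (forall_congr' (exists_sigmaWC_diagonal_iff hP))⟩
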